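/- All graphs are finite and simple; $\alpha(G)$ is the independence number and $\chi(G)$ the chromatic number of $G$, and $C_k$ is the cycle on $k$ vertices. A graph $G$ contains a graph $H$ as an immersion if there are an injective map $\phi\colon V(H)\to V(G)$ and, for every edge $uv\in E(H)$, a path $P_{uv}$ in $G$ with endpoints $\phi(u)$ and $\phi(v)$, such that the paths $P_{uv}$, $uv\in E(H)$, are pairwise edge disjoint and no vertex of $\phi(V(H))$ is an interior vertex of any of these paths. Theorem. Let $G$ be a graph with $\alpha(G)\ge 2$ such that, for every integer $k$ with $4\le k\le 2\alpha(G)$, $G$ has no induced subgraph isomorphic to $C_k$. Then $G$ contains the complete graph $K_{\chi(G)}$ as an immersion. -/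

import Mathlib

namespace SimpleGraph

/-- An immersion of `H` in `G` (in the strong sense): an injection of the vertices of `H` into those
of `G`, together with one path of `G` for each edge of `H`, joining the images of the ends of that
edge, such that the paths are pairwise edge disjoint and no branch vertex is an interior vertex of
any of the paths. The path of the edge `uv` is given with both of its orientations, from `u` to `v`
and from `v` to `u`; `path_symm` says that these are the same path. -/
structure Immersion {W V : Type*} (H : SimpleGraph W) (G : SimpleGraph V) where
  /-- The map to the branch vertices. -/
  branch : W ↪ V
  /-- The path for the edge `uv`. -/
  path : ∀ {u v : W}, H.Adj u v → G.Walk (branch u) (branch v)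
  path_symm : ∀ {u v : W} (h : H.Adj u v), path h.symm = (path h).reverse
  isPath : ∀ {u v : W} (h : H.Adj u v), (path h).IsPath
  edge_disjoint : ∀ {u v u' v' : W} (h : H.Adj u v) (h' : H.Adj u' v'), s(u, v) ≠ s(u', v') →
    List.Disjoint (path h).edges (path h').edges
  branch_not_interior : ∀ {u v : W} (h : H.Adj u v) (w : W),
    branch w ∈ (path h).support → branch w = branch u ∨ branch w = branch v

/-- `G` contains `H` as an immersion. -/
def ContainsImmersion {V W : Type*} (G : SimpleGraph V) (H : SimpleGraph W) : Prop :=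
  Nonempty (Immersion H G)

/-- `G` is finitely colourable and contains the complete graph on `χ(G)` vertices as an
immersion. -/
def SatisfiesLescureMeyniel {V : Type*} (G : SimpleGraph V) : Prop :=
  ∃ n : ℕ, G.chromaticNumber = n ∧ G.ContainsImmersion (completeGraph (Fin n))

end SimpleGraph

/-!
Put `a = α(G)`. If `G` has no hole, it is chordal, and repeatedly removing a simplicial vertex shows
`χ(G) = ω(G)`. Otherwise every hole of `G` has exactly `2a + 1` vertices, since a longer one would
contain `a + 1` independent vertices. Every other vertex sees either the whole hole or three
consecutive vertices of it, so `G` is an odd wheel whose vertices have been inflated to cliques: a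
hub `A_0` and rim classes `A_1, …, A_{2a+1}`, rotated so that the last one is smallest.

If `G` has no clique on `t = χ(G)` vertices, let `k` be `t` minus the size of the clique
`A_0 ∪ A_1 ∪ A_{2a+1}`. An even class with fewer than `k` vertices would allow a colouring of `G`
with `t - 1` colours, so every even class has at least `k` vertices. Then `A_0 ∪ A_1 ∪ A_{2a+1}` and
`k` vertices of `A_2` are the branch vertices of an immersion of `K_t`: the only missing edges join
`A_2` to `A_{2a+1}`, and are replaced by paths running through `A_3, …, A_{2a}` that keep a fixed
position in the even classes and a fixed position in the odd classes. Every edge of such a path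
determines both positions, hence the path.
-/

namespace LescureMeyniel

open Finset SimpleGraph

variable {V : Type*} {G : SimpleGraph V}

/-! ### Immersions -/

theorem exists_symmetric_walks {W : Type*} {H : SimpleGraph W} {b : W → V}
    {P : ∀ u v : W, G.Walk (b u) (b v) → Prop}
    (hP : ∀ {u v : W} {w : G.Walk (b u) (b v)}, P u v w → P v u w.reverse)
    (hex : ∀ u v : W, H.Adj u v → ∃ w, P u v w) :
    ∃ Q : ∀ {u v : W}, H.Adj u v → G.Walk (b u) (b v),
      (∀ {u v : W} (h : H.Adj u v), Q h.symm = (Q h).reverse) ∧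
      ∀ {u v : W} (h : H.Adj u v), P u v (Q h) := by
  classical
  let _ := linearOrderOfSTO (WellOrderingRel (α := W))
  choose q hq using hex
  refine ⟨fun {u v} h => if u < v then q u v h else (q v u h.symm).reverse, fun h => ?_,
    fun h => ?_⟩
  · rcases h.ne.lt_or_gt with hlt | hgt
    · simp only [if_pos hlt, if_neg hlt.asymm]
    · simp only [if_pos hgt, if_neg hgt.asymm, Walk.reverse_reverse]
  · dsimp only
    split_ifs
    · exact hq _ _ h
    · exact hP (hq _ _ h.symm)

-- Folding by `g` sends all edges of a walk to one pair, so walks for different pairs are disjoint.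
theorem containsImmersion_of_walks {W κ : Type*} {H : SimpleGraph W} (b : W ↪ V) {g : V → κ}
    (hg : Function.Injective (g ∘ b))
    (hwalk : ∀ u v : W, H.Adj u v → ∃ w : G.Walk (b u) (b v),
      (∀ e ∈ w.edges, e.map g = s(g (b u), g (b v))) ∧
      ∀ z : W, b z ∈ w.support → z = u ∨ z = v) :
    G.ContainsImmersion H := by
  classical
  obtain ⟨Q, hsymm, hQ⟩ := exists_symmetric_walks (H := H) (b := b)
    (P := fun u v w => w.IsPath ∧ (∀ e ∈ w.edges, e.map g = s(g (b u), g (b v))) ∧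
      ∀ z : W, b z ∈ w.support → z = u ∨ z = v)
    (fun h => ⟨h.1.reverse, fun e he => (h.2.1 e (by simpa using he)).trans Sym2.eq_swap,
      fun z hz => (h.2.2 z (by simpa using hz)).symm⟩)
    (fun u v h => by
      obtain ⟨w, hfold, hint⟩ := hwalk u v h
      exact ⟨w.bypass, w.bypass_isPath, fun e he => hfold e (w.edges_bypass_subset_edges he),
        fun z hz => hint z (w.support_bypass_subset_support hz)⟩)
  refine ⟨⟨b, Q, hsymm, fun h => (hQ h).1, fun {u v u' v'} h h' hne e he he' => hne ?_,
    fun h z hz => ((hQ h).2.2 z hz).imp (congrArg b) (congrArg b)⟩⟩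
  have hfold : s(g (b u), g (b v)) = s(g (b u'), g (b v')) :=
    ((hQ h).2.1 e he).symm.trans ((hQ h').2.1 e he')
  exact Sym2.map.injective hg hfold

theorem containsImmersion_completeGraph_of_walks {κ : Type*} (S : Finset V) {g : V → κ}
    (hg : Set.InjOn g S)
    (hwalk : ∀ x ∈ S, ∀ y ∈ S, x ≠ y → ∃ w : G.Walk x y,
      (∀ e ∈ w.edges, e.map g = s(g x, g y)) ∧ ∀ z ∈ w.support, z ∈ S → z = x ∨ z = y) :
    G.ContainsImmersion (completeGraph (Fin #S)) := by
  let b : Fin #S ↪ V := S.equivFin.symm.toEmbedding.trans (.subtype (· ∈ S))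
  have hb (u : Fin #S) : b u ∈ S := (S.equivFin.symm u).2
  refine containsImmersion_of_walks b
    (fun u v huv => b.injective (hg (hb u) (hb v) huv)) fun u v huv => ?_
  obtain ⟨w, hfold, hint⟩ := hwalk _ (hb u) _ (hb v) (b.injective.ne huv)
  exact ⟨w, hfold, fun z hz => (hint _ hz (hb z)).imp (b.injective ·) (b.injective ·)⟩

theorem containsImmersion_of_isClique {S : Finset V} (hS : G.IsClique S) {t : ℕ} (ht : t ≤ #S) :
    G.ContainsImmersion (completeGraph (Fin t)) := by
  obtain ⟨T, hTS, rfl⟩ := exists_subset_card_eq ht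
  refine containsImmersion_completeGraph_of_walks T (g := id) Function.injective_id.injOn
    fun x hx y hy hxy => ⟨(hS (hTS hx) (hTS hy) hxy).toWalk, ?_, ?_⟩ <;> simp

/-! ### Induced cycles and shortest paths -/

theorem cycleGraph_adj_iff_val {n : ℕ} (hn : 2 ≤ n) {u v : Fin n} :
    (cycleGraph n).Adj u v ↔ u.val + 1 = v.val ∨ v.val + 1 = u.val ∨
      (u.val = 0 ∧ v.val + 1 = n) ∨ (v.val = 0 ∧ u.val + 1 = n) := by
  have hsub (x y : Fin n) :
      (x - y).val = 1 ↔ y.val + 1 = x.val ∨ (x.val = 0 ∧ y.val + 1 = n) := by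
    rw [Fin.val_sub]
    rcases lt_or_ge x.val y.val with h | h
    · rw [Nat.mod_eq_of_lt (by omega)]
      omega
    · rw [show n - y.val + x.val = n + (x.val - y.val) by omega, Nat.add_mod_left,
        Nat.mod_eq_of_lt (by omega)]
      omega
  rw [cycleGraph_adj', hsub, hsub]
  tauto

theorem cycleGraph_isIndContained_of_path {m : ℕ} (f : pathGraph (m + 1) ↪g G) {r : V}
    (hr : r ∉ Set.range f) (hadj : ∀ i, G.Adj r (f i) ↔ i = 0 ∨ i = Fin.last m) :
    cycleGraph (m + 2) ⊴ G := by
  let g : Fin (m + 2) → V := Fin.snoc f r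
  have hg (i j : Fin (m + 2)) : G.Adj (g i) (g j) ↔ (cycleGraph (m + 2)).Adj i j := by
    rw [cycleGraph_adj_iff_val (by omega)]
    induction i using Fin.lastCases <;> induction j using Fin.lastCases <;>
      simp only [g, Fin.snoc_castSucc, Fin.snoc_last, G.adj_comm _ r, f.map_adj_iff,
        pathGraph_adj, hadj, G.irrefl, Fin.ext_iff, Fin.val_castSucc, Fin.val_last,
        Fin.val_zero, and_true, false_iff] <;> omega
  exact ⟨⟨⟨g, Fin.snoc_injective_iff.2 ⟨f.injective, hr⟩⟩, hg _ _⟩⟩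

theorem cycleGraph_four_isIndContained {a b c d : V} (hab : G.Adj a b) (hbc : G.Adj b c)
    (hcd : G.Adj c d) (hda : G.Adj d a) (hac : a ≠ c) (hac' : ¬ G.Adj a c) (hbd : b ≠ d)
    (hbd' : ¬ G.Adj b d) : cycleGraph 4 ⊴ G := by
  have hinj : Function.Injective ![a, b, c, d] := by
    intro i j
    fin_cases i <;> fin_cases j <;>
      simp [hab.ne, hab.ne', hbc.ne, hbc.ne', hcd.ne, hcd.ne', hda.ne, hda.ne', hac, hac.symm,
        hbd, hbd.symm]
  have hadj (i j : Fin 4) :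
      G.Adj (![a, b, c, d] i) (![a, b, c, d] j) ↔ (cycleGraph 4).Adj i j := by
    rw [cycleGraph_adj_iff_val (by omega)]
    fin_cases i <;> fin_cases j <;>
      simp [hab, hab.symm, hbc, hbc.symm, hcd, hcd.symm, hda, hda.symm, hac', hbd',
        G.adj_comm c a, G.adj_comm d b]
  exact ⟨⟨⟨_, hinj⟩, hadj _ _⟩⟩

theorem exists_pathGraph_embedding {u v : V} (huv : G.Reachable u v) :
    ∃ f : pathGraph (G.dist u v + 1) ↪g G, f 0 = u ∧ f (Fin.last _) = v := by
  obtain ⟨w, hw⟩ := huv.exists_walk_length_eq_dist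
  let p (i : Fin (G.dist u v + 1)) : V := w.getVert i
  have hdist (i) : G.dist u (p i) = i := by
    rw [← length_eq_dist_of_subwalk hw (w.isSubwalk_take i), Walk.take_length, hw]
    omega
  have hinj : Function.Injective p := fun i j hij =>
    Fin.ext ((hdist i).symm.trans ((congrArg (G.dist u) hij).trans (hdist j)))
  have hsucc {i j : Fin (G.dist u v + 1)} (hij : i.val + 1 = j.val) : G.Adj (p i) (p j) := by
    have := w.adj_getVert_succ (i := i) (by omega)
    rwa [hij] at this
  have hadj (i j) : G.Adj (p i) (p j) ↔ (pathGraph (G.dist u v + 1)).Adj i j := by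
    rw [pathGraph_adj]
    refine ⟨fun h => ?_, fun h => h.elim hsucc fun h => (hsucc h).symm⟩
    have hne : i.val ≠ j.val := fun hij => h.ne (congrArg p (Fin.ext hij))
    have hij := h.diff_dist_adj (u := u)
    rw [hdist, hdist] at hij
    omega
  exact ⟨⟨⟨p, hinj⟩, hadj _ _⟩, w.getVert_zero, by simp [p, ← hw]⟩

/-! ### Chordal graphs -/

/-- `G` has no induced cycle of a length between `4` and `ℓ`. -/
def HoleFreeUpTo (G : SimpleGraph V) (ℓ : ℕ) : Prop :=
  ∀ k, 4 ≤ k → k ≤ ℓ → ¬ cycleGraph k ⊴ G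

/-- A graph is chordal if it has no induced cycle of length at least `4`. -/
def IsChordal (G : SimpleGraph V) : Prop :=
  ∀ k, 4 ≤ k → ¬ cycleGraph k ⊴ G

theorem IsChordal.induce (hG : IsChordal G) (s : Set V) : IsChordal (G.induce s) :=
  fun k hk h => hG k hk (h.trans ⟨Embedding.induce s⟩)

theorem connected_induce_insert {C : Set V} (hC : (G.induce C).Connected) {x z : V} (hz : z ∈ C)
    (hxz : G.Adj x z) : (G.induce (insert x C)).Connected := by
  have h := induce_union_connected (induce_pair_connected_of_adj hxz).preconnected
    hC.preconnected ⟨z, by simp, hz⟩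
  rwa [Set.insert_union, Set.singleton_union, Set.insert_eq_of_mem hz] at h

-- Otherwise `v` closes a shortest path from `x` to `y` through `C` to a hole.
theorem IsChordal.adj_of_connected (hG : IsChordal G) {C : Set V} (hC : (G.induce C).Connected)
    {v x y : V} (hv : v ∉ C) (hvC : ∀ z ∈ C, ¬ G.Adj v z) (hvx : G.Adj v x) (hvy : G.Adj v y)
    (hxy : x ≠ y) (hx : ∃ z ∈ C, G.Adj x z) (hy : ∃ z ∈ C, G.Adj y z) : G.Adj x y := by
  by_contra hnadj
  obtain ⟨⟨z, hz, hxz⟩, ⟨z', hz', hyz'⟩⟩ := hx, hy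
  set D : Set V := insert x (insert y C) with hD
  have hconn : (G.induce D).Connected :=
    connected_induce_insert (connected_induce_insert hC hz' hyz') (.inr hz) hxz
  let s : D := ⟨x, by simp [hD]⟩
  let t : D := ⟨y, by simp [hD]⟩
  have hne : (G.induce D).dist s t ≠ 0 :=
    dist_ne_zero_iff_ne_and_reachable.2 ⟨fun h => hxy (congrArg Subtype.val h), hconn s t⟩
  have hne' : (G.induce D).dist s t ≠ 1 := fun h => hnadj <|
    (dist_eq_one_iff_adj (G := G.induce D)).1 h
  obtain ⟨f, hf, hf'⟩ := exists_pathGraph_embedding (hconn s t)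
  refine hG _ (by omega) (cycleGraph_isIndContained_of_path
    ((Embedding.induce D).comp f) (r := v) ?_ fun i => ⟨fun h => ?_, ?_⟩)
  · rintro ⟨i, rfl⟩
    obtain h | h | h := (f i).2
    exacts [hvx.ne h, hvy.ne h, hv h]
  · obtain hi | hi | hi := (f i).2
    · exact .inl (f.injective ((Subtype.ext hi).trans hf.symm))
    · exact .inr (f.injective ((Subtype.ext hi).trans hf'.symm))
    · exact absurd h (hvC _ hi)
  · rintro (rfl | rfl)
    · simpa [hf] using hvx
    · simpa [hf'] using hvy

/-- The vertices outside `C` without a neighbour in `C`. -/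
def antineighborSet (G : SimpleGraph V) (C : Set V) : Set V :=
  {r | r ∉ C ∧ ∀ z ∈ C, ¬ G.Adj r z}

theorem exists_connected_forall_adj_antineighborSet [Finite V] (hG : G ≠ ⊤) :
    ∃ C : Set V, (G.induce C).Connected ∧ (antineighborSet G C).Nonempty ∧
      ∀ x ∉ C, (∃ z ∈ C, G.Adj x z) → ∀ r ∈ antineighborSet G C, G.Adj x r := by
  obtain ⟨u, w, hne, hnadj⟩ := ne_top_iff_exists_not_adj.1 hG
  have huw : (G.induce {u}).Connected ∧ (antineighborSet G {u}).Nonempty :=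
    ⟨by simp, w, by simpa [antineighborSet, G.adj_comm w] using ⟨hne.symm, hnadj⟩⟩
  obtain ⟨C, -, hC⟩ := Finite.exists_le_maximal
    (p := fun C : Set V => (G.induce C).Connected ∧ (antineighborSet G C).Nonempty) huw
  refine ⟨C, hC.prop.1, hC.prop.2, fun x hx ⟨z, hz, hxz⟩ r hr => by_contra fun hxr => ?_⟩
  have hne : r ≠ x := by
    rintro rfl
    exact hr.2 z hz hxz
  have hr' : r ∈ antineighborSet G (insert x C) := by
    simpa [antineighborSet, hne, G.adj_comm r x, hxr] using hr
  exact hx (hC.le_of_ge ⟨connected_induce_insert hC.prop.1 hz hxz, r, hr'⟩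
    (Set.subset_insert x C) (.inl rfl))

theorem IsChordal.exists_isClique_neighborSet [Finite V] [Nonempty V] (hG : IsChordal G) :
    ∃ v, G.IsClique (G.neighborSet v) := by
  induction hn : Nat.card V using Nat.strong_induction_on generalizing V with
  | _ n ih =>
  by_cases htop : G = ⊤
  · subst htop
    exact ⟨Classical.arbitrary V, fun x _ y _ hxy => hxy⟩
  obtain ⟨C, hC, hne, hdom⟩ := exists_connected_forall_adj_antineighborSet htop
  have := hne.to_subtype
  have hlt : Nat.card (antineighborSet G C) < n := by
    obtain ⟨z, hz⟩ := hC.nonempty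
    exact hn ▸ Finite.card_subtype_lt (x := z) fun h => h.1 hz
  obtain ⟨⟨v, hv⟩, hvR⟩ := ih _ hlt (hG.induce (antineighborSet G C)) rfl
  have hN (x) (hx : G.Adj v x) : x ∈ antineighborSet G C ∨ x ∉ C ∧ ∃ z ∈ C, G.Adj x z := by
    have hxC : x ∉ C := fun h => hv.2 x h hx
    by_cases h : ∃ z ∈ C, G.Adj x z
    · exact .inr ⟨hxC, h⟩
    · exact .inl ⟨hxC, by simpa using h⟩
  refine ⟨v, fun x hx y hy hxy => ?_⟩
  rcases hN x hx, hN y hy with ⟨hxR | ⟨hxC, hx'⟩, hyR | ⟨hyC, hy'⟩⟩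
  · exact hvR (x := ⟨x, hxR⟩) hx (y := ⟨y, hyR⟩) hy (by simpa using hxy)
  · exact (hdom y hyC hy' x hxR).symm
  · exact hdom x hxC hx' y hyR
  · exact hG.adj_of_connected hC hv.1 hv.2 hx hy hxy hx' hy'

theorem colorable_of_induce_compl_singleton {v : V} [Fintype (G.neighborSet v)] {n : ℕ}
    (h : (G.induce {v}ᶜ).Colorable n) (hdeg : G.degree v < n) : G.Colorable n := by
  classical
  obtain ⟨f⟩ := h
  obtain ⟨c, hc⟩ : ∃ c, c ∉ univ.image fun u : G.neighborSet v => f ⟨u, u.2.ne'⟩ := by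
    by_contra! hall
    have := card_le_card (fun c _ => hall c : univ ⊆ _) |>.trans card_image_le
    simp only [card_univ, Fintype.card_fin, card_neighborSet_eq_degree] at this
    omega
  have hc' {u : V} (hu : G.Adj v u) : f ⟨u, hu.ne'⟩ ≠ c := fun h =>
    hc (mem_image.2 ⟨⟨u, hu⟩, mem_univ _, h⟩)
  refine ⟨Coloring.mk (fun u => if hu : u = v then c else f ⟨u, hu⟩) fun {x y} hxy => ?_⟩
  by_cases hx : x = v <;> by_cases hy : y = v
  · exact absurd (hx.trans hy.symm) hxy.ne
  · subst hx
    simpa [hy] using (hc' hxy).symm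
  · subst hy
    simpa [hx] using hc' hxy.symm
  · simpa [hx, hy] using f.valid (v := ⟨x, hx⟩) (w := ⟨y, hy⟩) hxy

theorem IsChordal.colorable [Finite V] (hG : IsChordal G) {s : ℕ} (hs : G.CliqueFree (s + 1)) :
    G.Colorable s := by
  classical
  induction hn : Nat.card V using Nat.strong_induction_on generalizing V with
  | _ n ih =>
  rcases isEmpty_or_nonempty V with _ | _
  · exact .of_isEmpty s
  obtain ⟨v, hv⟩ := hG.exists_isClique_neighborSet
  have := Fintype.ofFinite V
  have hlt : Nat.card ({v}ᶜ : Set V) < n :=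
    hn ▸ Finite.card_subtype_lt (x := v) (by simp)
  refine colorable_of_induce_compl_singleton (ih _ hlt (hG.induce _)
    (hs.comap ⟨(Embedding.induce {v}ᶜ).toCopy⟩) rfl) (lt_of_not_ge fun hle => ?_)
  obtain ⟨T, hT, hcard⟩ := exists_subset_card_eq hle
  have hadj (u) (hu : u ∈ T) : G.Adj v u := (G.mem_neighborFinset v u).1 (hT hu)
  exact hs _ (IsNClique.insert ⟨hv.subset hadj, hcard⟩ hadj)

/-! ### Holes and traces -/

section Arc

variable {n : ℕ}

theorem natCast_inj_of_lt {x y : ℕ} (hx : x < n) (hy : y < n) : (x : ZMod n) = y ↔ x = y :=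
  (CharP.natCast_injOn_Iio (ZMod n) n).eq_iff hx hy

theorem one_two_three_four_ne_zero (hn : 5 ≤ n) :
    (1 : ZMod n) ≠ 0 ∧ (2 : ZMod n) ≠ 0 ∧ (3 : ZMod n) ≠ 0 ∧ (4 : ZMod n) ≠ 0 := by
  have h (k : ℕ) (hk : 0 < k) (hkn : k < n) : (k : ZMod n) ≠ 0 := by
    simpa using (natCast_inj_of_lt hkn (hk.trans hkn)).not.2 hk.ne'
  exact ⟨by simpa using h 1 one_pos (by omega), h 2 two_pos (by omega), h 3 three_pos (by omega),
    h 4 four_pos (by omega)⟩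

theorem eq_add_one_iff_val [NeZero n] (hn : 2 ≤ n) (i j : ZMod n) :
    j = i + 1 ↔ j.val = i.val + 1 ∨ (j.val = 0 ∧ i.val + 1 = n) := by
  have hi := ZMod.val_lt i
  have hj := ZMod.val_lt j
  rw [← (ZMod.val_injective n).eq_iff, ZMod.val_add, ZMod.val_one'' (by omega)]
  rcases eq_or_ne (i.val + 1) n with h | h
  · rw [h, Nat.mod_self]
    omega
  · rw [Nat.mod_eq_of_lt (by omega)]
    omega

theorem exists_mem_add_one_notMem [NeZero n] {s : Set (ZMod n)} (hs : s.Nonempty)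
    (hs' : s ≠ Set.univ) : ∃ i ∈ s, i + 1 ∉ s := by
  by_contra! h
  obtain ⟨i, hi⟩ := hs
  have hadd (m : ℕ) : i + m ∈ s := by
    induction m with
    | zero => simpa using hi
    | succ m ih => simpa [add_assoc] using h _ ih
  refine hs' (Set.eq_univ_of_forall fun j => ?_)
  simpa using hadd (j - i).val

/-- The three consecutive points of `ZMod n` with middle point `i`. -/
def arc (i : ZMod n) : Set (ZMod n) :=
  {i - 1, i, i + 1}

theorem mem_arc {i j : ZMod n} : j ∈ arc i ↔ j = i - 1 ∨ j = i ∨ j = i + 1 :=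
  Iff.rfl

theorem mem_arc_comm {i j : ZMod n} : i ∈ arc j ↔ j ∈ arc i := by
  rw [mem_arc, mem_arc]
  grind

theorem arc_eq_of_forall_ne (hn : 5 ≤ n) {i j k : ZMod n}
    (h : ∀ l ≠ k, l ∈ arc i ↔ l ∈ arc j) : i = j := by
  have hne := one_two_three_four_ne_zero hn
  simp only [mem_arc] at h
  have h' (l : ZMod n) := or_iff_not_imp_left.2 (h l)
  have hi : _ ∧ _ ∧ _ := ⟨h' i, h' (i + 1), h' (i - 1)⟩
  have hj : _ ∧ _ ∧ _ := ⟨h' j, h' (j + 1), h' (j - 1)⟩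
  clear h h'
  grind

theorem arc_injective (hn : 5 ≤ n) : Function.Injective (arc : ZMod n → Set (ZMod n)) :=
  fun i j h => arc_eq_of_forall_ne hn (k := i) fun l _ => by rw [h]

theorem exists_ne_notMem_arc (hn : 5 ≤ n) (i k : ZMod n) : ∃ l ≠ k, l ∉ arc i := by
  obtain ⟨h1, h2, h3, h4⟩ := one_two_three_four_ne_zero hn
  have hr : i + 2 ∉ arc i := by
    rw [mem_arc]
    rintro (h | h | h)
    · exact h3 (by linear_combination h)
    · exact h2 (by linear_combination h)
    · exact h1 (by linear_combination h)
  have hl : i - 2 ∉ arc i := by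
    rw [mem_arc]
    rintro (h | h | h)
    · exact h1 (by linear_combination -h)
    · exact h2 (by linear_combination -h)
    · exact h3 (by linear_combination -h)
  by_cases h : i + 2 = k
  · exact ⟨i - 2, fun h' => h4 (by linear_combination h - h'), hl⟩
  · exact ⟨i + 2, h, hr⟩

end Arc

/-- `c` runs through the vertices of an induced cycle of `G` in cyclic order. -/
structure IsHole {n : ℕ} (G : SimpleGraph V) (c : ZMod n → V) : Prop where
  injective : Function.Injective c
  adj_iff : ∀ i j, G.Adj (c i) (c j) ↔ j = i + 1 ∨ i = j + 1

/-- The positions on the cycle `c` of the vertices in the closed neighbourhood of `v`. -/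
def closedTrace {n : ℕ} (G : SimpleGraph V) (c : ZMod n → V) (v : V) : Set (ZMod n) :=
  {j | v = c j ∨ G.Adj v (c j)}

section IsHole

variable {n : ℕ} {c : ZMod n → V} {u v : V}

theorem mem_closedTrace {j : ZMod n} : j ∈ closedTrace G c v ↔ v = c j ∨ G.Adj v (c j) :=
  Iff.rfl

theorem IsHole.closedTrace_self (hc : IsHole G c) (i : ZMod n) :
    closedTrace G c (c i) = arc i := by
  ext j
  rw [mem_closedTrace, mem_arc, hc.adj_iff, hc.injective.eq_iff]
  grind

theorem IsHole.adj_add_natCast_iff (hc : IsHole G c) (i : ZMod n) {x y : ℕ} (hx : x + 1 < n)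
    (hy : y + 1 < n) : G.Adj (c (i + x)) (c (i + y)) ↔ x + 1 = y ∨ y + 1 = x := by
  rw [hc.adj_iff, add_assoc, add_assoc, add_right_inj, add_right_inj, ← Nat.cast_succ,
    ← Nat.cast_succ, natCast_inj_of_lt (by omega) hx, natCast_inj_of_lt (by omega) hy]
  omega

theorem IsHole.apply_add_natCast_inj (hc : IsHole G c) (i : ZMod n) {x y : ℕ} (hx : x < n)
    (hy : y < n) : c (i + x) = c (i + y) ↔ x = y := by
  rw [hc.injective.eq_iff, add_right_inj, natCast_inj_of_lt hx hy]

theorem IsHole.cycleGraph_isIndContained_of_gap (hc : IsHole G c) (hv : ∀ j, v ≠ c j)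
    {i : ZMod n} {d : ℕ} (hdn : d + 1 < n) (hi : G.Adj v (c i)) (hd : G.Adj v (c (i + d)))
    (hgap : ∀ m : ℕ, 0 < m → m < d → ¬ G.Adj v (c (i + m))) : cycleGraph (d + 2) ⊴ G := by
  let f : pathGraph (d + 1) ↪g G :=
    ⟨⟨fun m => c (i + m.val), fun x y h =>
      Fin.ext ((hc.apply_add_natCast_inj i (by omega) (by omega)).1 h)⟩, fun {x y} =>
      (hc.adj_add_natCast_iff i (by omega) (by omega)).trans pathGraph_adj.symm⟩
  have hf (m : Fin (d + 1)) : f m = c (i + m.val) := rfl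
  refine cycleGraph_isIndContained_of_path f (fun ⟨m, hm⟩ => hv _ hm.symm) fun m =>
    ⟨fun h => ?_, ?_⟩
  · simp only [Fin.ext_iff, Fin.val_zero, Fin.val_last]
    by_contra! hm
    exact hgap m (by omega) (by omega) h
  · rintro (rfl | rfl)
    · simpa [hf] using hi
    · simpa [hf] using hd

theorem IsHole.sub_one_ne_add_one (hn : 5 ≤ n) (hc : IsHole G c) (i : ZMod n) :
    c (i - 1) ≠ c (i + 1) ∧ ¬ G.Adj (c (i - 1)) (c (i + 1)) := by
  obtain ⟨h1, h2, h3, -⟩ := one_two_three_four_ne_zero hn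
  rw [hc.injective.ne_iff, hc.adj_iff, not_or]
  exact ⟨fun h => h2 (by linear_combination -h), fun h => h1 (by linear_combination h),
    fun h => h3 (by linear_combination -h)⟩

theorem IsHole.adj_pair_of_mem_closedTrace (hn : 5 ≤ n) (hc : IsHole G c) {i : ZMod n}
    (h : i - 1 ∈ closedTrace G c v) (h' : i + 1 ∈ closedTrace G c v) :
    G.Adj v (c (i - 1)) ∧ G.Adj v (c (i + 1)) := by
  have hi := hc.sub_one_ne_add_one hn i
  rw [mem_closedTrace] at h h'
  grind [G.adj_comm]

theorem IsHole.adj_of_mem_closedTrace (hn : 5 ≤ n) (hc : IsHole G c) (h4 : ¬ cycleGraph 4 ⊴ G)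
    (huv : u ≠ v) {i : ZMod n} (hu : i - 1 ∈ closedTrace G c u) (hu' : i + 1 ∈ closedTrace G c u)
    (hv : i - 1 ∈ closedTrace G c v) (hv' : i + 1 ∈ closedTrace G c v) : G.Adj u v := by
  obtain ⟨hu, hu'⟩ := hc.adj_pair_of_mem_closedTrace hn hu hu'
  obtain ⟨hv, hv'⟩ := hc.adj_pair_of_mem_closedTrace hn hv hv'
  obtain ⟨hne, hnadj⟩ := hc.sub_one_ne_add_one hn i
  by_contra huv'
  exact h4 (cycleGraph_four_isIndContained hu hv.symm hv' hu'.symm huv huv' hne hnadj)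

theorem IsHole.update (hn : 5 ≤ n) (hc : IsHole G c) {i : ZMod n}
    (hu : closedTrace G c u = arc i) : IsHole G (Function.update c i u) := by
  obtain ⟨h1, -, -, -⟩ := one_two_three_four_ne_zero hn
  have hne {j : ZMod n} (hj : j ≠ i) : u ≠ c j := by
    rintro rfl
    exact hj (arc_injective hn ((hc.closedTrace_self j).symm.trans hu))
  have hadj {j : ZMod n} (hj : j ≠ i) : G.Adj u (c j) ↔ j = i - 1 ∨ j = i + 1 := by
    have := Set.ext_iff.1 hu j
    rw [mem_closedTrace, mem_arc] at this
    grind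
  refine ⟨fun x y hxy => ?_, fun x y => ?_⟩
  · have := @hc.injective x y
    grind [Function.update_apply]
  · by_cases hx : x = i <;> by_cases hy : y = i
    · simp [hx, hy, h1]
    · rw [hx, Function.update_self, Function.update_of_ne hy, hadj hy]
      grind
    · rw [hy, Function.update_self, Function.update_of_ne hx, G.adj_comm, hadj hx]
      grind
    · rw [Function.update_of_ne hx, Function.update_of_ne hy, hc.adj_iff]

end IsHole

section Classification

variable {a : ℕ} {c : ZMod (2 * a + 1) → V} {u v : V}

theorem exists_adj_of_indepSetFree {m : ℕ} (h : G.IndepSetFree m) {g : Fin m → V}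
    (hg : Function.Injective g) : ∃ i j, G.Adj (g i) (g j) := by
  by_contra! hadj
  refine h (univ.map ⟨g, hg⟩) ⟨?_, by simp⟩
  rintro x hx y hy -
  obtain ⟨⟨i, -, rfl⟩, ⟨j, -, rfl⟩⟩ := mem_map.1 hx, mem_map.1 hy
  exact hadj i j

theorem IsHole.exists_adj_odd (hind : G.IndepSetFree (a + 1)) (hc : IsHole G c)
    (hv : ∀ j, v ≠ c j) (i : ZMod (2 * a + 1)) :
    ∃ m < a, G.Adj v (c (i + (2 * m + 1 : ℕ))) := by
  let g : Fin a → V := fun m => c (i + (2 * m.val + 1 : ℕ))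
  have hg : Function.Injective g := fun x y h => by
    have := (hc.apply_add_natCast_inj i (by omega) (by omega)).1 h
    omega
  have hgg (x y : Fin a) : ¬ G.Adj (g x) (g y) := fun h => by
    have := (hc.adj_add_natCast_iff i (by omega) (by omega)).1 h
    omega
  obtain ⟨x, y, hxy⟩ := exists_adj_of_indepSetFree hind (g := Fin.cons v g)
    (Fin.cons_injective_iff.2 ⟨fun ⟨m, hm⟩ => hv _ hm.symm, hg⟩)
  induction x using Fin.cases with
  | zero =>
    induction y using Fin.cases with
    | zero => exact absurd hxy G.irrefl
    | succ y => exact ⟨y, y.2, hxy⟩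
  | succ x =>
    induction y using Fin.cases with
    | zero => exact ⟨x, x.2, hxy.symm⟩
    | succ y => exact absurd hxy (hgg x y)

theorem IsHole.adj_add_and_forall_lt_not_adj (hind : G.IndepSetFree (a + 1))
    (hfree : HoleFreeUpTo G (2 * a)) (hc : IsHole G c) (hv : ∀ j, v ≠ c j)
    {i : ZMod (2 * a + 1)} (hi : G.Adj v (c i)) (hi' : ¬ G.Adj v (c (i + 1))) :
    G.Adj v (c (i + (2 * a - 1 : ℕ))) ∧
      ∀ m : ℕ, 0 < m → m < 2 * a - 1 → ¬ G.Adj v (c (i + m)) := by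
  classical
  obtain ⟨m, hma, hm⟩ := hc.exists_adj_odd hind hv i
  obtain ⟨d, ⟨hd0, hd⟩, hgap⟩ := Nat.findX (p := fun d : ℕ => 0 < d ∧ G.Adj v (c (i + d)))
    ⟨2 * m + 1, by omega, hm⟩
  simp only [not_and] at hgap
  have hd1 : d ≠ 1 := by
    rintro rfl
    exact hi' (by simpa using hd)
  have hdle : d ≤ 2 * a - 1 := by
    by_contra! hlt
    exact hgap (2 * m + 1) (by omega) (by omega) hm
  obtain rfl : d = 2 * a - 1 := by
    by_contra hne
    exact hfree (d + 2) (by omega) (by omega)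
      (hc.cycleGraph_isIndContained_of_gap hv (by omega) hi hd fun m h h' => hgap m h' h)
  exact ⟨hd, fun m h h' => hgap m h' h⟩

theorem IsHole.adj_add_natCast_iff_of_not_adj (ha : 2 ≤ a) (hind : G.IndepSetFree (a + 1))
    (hfree : HoleFreeUpTo G (2 * a)) (hc : IsHole G c) (hv : ∀ j, v ≠ c j)
    {i : ZMod (2 * a + 1)} (hi : G.Adj v (c i)) (hi' : ¬ G.Adj v (c (i + 1))) {m : ℕ}
    (hm : m < 2 * a + 1) : G.Adj v (c (i + m)) ↔ m = 0 ∨ 2 * a - 1 ≤ m := by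
  obtain ⟨hd, hgap⟩ := hc.adj_add_and_forall_lt_not_adj hind hfree hv hi hi'
  have hlast : G.Adj v (c (i + (2 * a : ℕ))) := by
    by_contra hnadj
    have hcast (x : ℕ) : i + (2 * a - 1 : ℕ) + x = i + (2 * a - 1 + x : ℕ) := by
      push_cast
      ring
    refine hfree 4 le_rfl (by omega)
      (hc.cycleGraph_isIndContained_of_gap (d := 2) hv (by omega) hd ?_ fun m h h' => ?_)
    · have hwrap : ((2 * a - 1 + 2 : ℕ) : ZMod (2 * a + 1)) = 0 := by
        rw [show 2 * a - 1 + 2 = 2 * a + 1 by omega, ZMod.natCast_self]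
      rwa [hcast, hwrap, add_zero]
    · rwa [hcast, show 2 * a - 1 + m = 2 * a by omega]
  constructor
  · intro h
    by_contra! hne
    exact hgap m (by omega) (by omega) h
  · rintro (rfl | hle)
    · simpa using hi
    · obtain rfl | rfl : m = 2 * a - 1 ∨ m = 2 * a := by omega
      exacts [hd, hlast]

theorem IsHole.closedTrace_eq_univ_or_arc (ha : 2 ≤ a) (hind : G.IndepSetFree (a + 1))
    (hfree : HoleFreeUpTo G (2 * a)) (hc : IsHole G c) (v : V) :
    closedTrace G c v = Set.univ ∨ ∃ i, closedTrace G c v = arc i := by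
  by_cases hv : ∃ i, v = c i
  · obtain ⟨i, rfl⟩ := hv
    exact .inr ⟨i, hc.closedTrace_self i⟩
  push Not at hv
  have hmem (j) : j ∈ closedTrace G c v ↔ G.Adj v (c j) := by simp [mem_closedTrace, hv]
  refine or_iff_not_imp_left.2 fun huniv => ?_
  obtain ⟨m, -, h⟩ := hc.exists_adj_odd hind hv 0
  obtain ⟨i, hi, hi'⟩ := exists_mem_add_one_notMem ⟨_, (hmem _).2 h⟩ huniv
  rw [hmem] at hi hi'
  refine ⟨i - 1, Set.ext fun j => ?_⟩
  obtain ⟨m, hm, rfl⟩ : ∃ m < 2 * a + 1, i + (m : ℕ) = j := ⟨(j - i).val, ZMod.val_lt _, by simp⟩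
  have hself : ((2 * a + 1 : ℕ) : ZMod (2 * a + 1)) = 0 := ZMod.natCast_self _
  push_cast at hself
  have hlast : i - 1 = i + (2 * a : ℕ) := by
    push_cast
    linear_combination -hself
  have hlast' : i - 1 - 1 = i + (2 * a - 1 : ℕ) := by
    rw [Nat.cast_sub (by omega)]
    push_cast
    linear_combination -hself
  have hi0 : i - 1 + 1 = i + (0 : ℕ) := by simp
  rw [hmem, hc.adj_add_natCast_iff_of_not_adj ha hind hfree hv hi hi' hm, mem_arc, hi0, hlast',
    hlast, add_right_inj, add_right_inj, add_right_inj, natCast_inj_of_lt hm (by omega),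
    natCast_inj_of_lt hm (by omega), natCast_inj_of_lt hm (by omega)]
  omega

theorem IsHole.adj_iff_of_closedTrace_eq_arc (ha : 2 ≤ a) (hind : G.IndepSetFree (a + 1))
    (hfree : HoleFreeUpTo G (2 * a)) (hc : IsHole G c) {i j : ZMod (2 * a + 1)} (hij : i ≠ j)
    (hu : closedTrace G c u = arc i) (hv : closedTrace G c v = arc j) :
    G.Adj u v ↔ j ∈ arc i := by
  have hn : 5 ≤ 2 * a + 1 := by omega
  have huv : v ≠ u := by
    rintro rfl
    exact hij (arc_injective hn (hu.symm.trans hv))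
  have hc' := hc.update hn hu
  have hmem {l} (hl : l ≠ i) : l ∈ closedTrace G (Function.update c i u) v ↔ l ∈ arc j := by
    rw [← hv, mem_closedTrace, mem_closedTrace, Function.update_of_ne hl]
  have htrace : closedTrace G (Function.update c i u) v = arc j := by
    rcases hc'.closedTrace_eq_univ_or_arc ha hind hfree v with h | ⟨k, h⟩
    · obtain ⟨l, hl, hlj⟩ := exists_ne_notMem_arc hn j i
      exact absurd ((hmem hl).1 (h ▸ Set.mem_univ l)) hlj
    · rw [h, arc_eq_of_forall_ne hn fun l hl => (h ▸ hmem hl :)]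
  rw [← mem_arc_comm, ← htrace, mem_closedTrace, Function.update_self, G.adj_comm]
  simp [huv]

theorem IsHole.exists_label (ha : 2 ≤ a) (hind : G.IndepSetFree (a + 1))
    (hfree : HoleFreeUpTo G (2 * a)) (hc : IsHole G c) :
    ∃ f : V → Option (ZMod (2 * a + 1)),
      ∀ u v, G.Adj u v ↔ u ≠ v ∧ ∀ i ∈ f u, ∀ j ∈ f v, j ∈ arc i := by
  have hn : 5 ≤ 2 * a + 1 := by omega
  have hlabel (v : V) : ∃ o : Option (ZMod (2 * a + 1)),
      closedTrace G c v = o.elim Set.univ arc := by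
    rcases hc.closedTrace_eq_univ_or_arc ha hind hfree v with h | ⟨i, h⟩
    exacts [⟨none, h⟩, ⟨some i, h⟩]
  choose f hf using hlabel
  have h4 : ¬ cycleGraph 4 ⊴ G := hfree 4 le_rfl (by omega)
  have hadj {u v : V} (k : ZMod (2 * a + 1)) (hu : arc k ⊆ closedTrace G c u)
      (hv : arc k ⊆ closedTrace G c v) : G.Adj u v ↔ u ≠ v :=
    ⟨Adj.ne, fun huv => hc.adj_of_mem_closedTrace hn h4 huv (hu (.inl rfl))
      (hu (.inr (.inr rfl))) (hv (.inl rfl)) (hv (.inr (.inr rfl)))⟩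
  refine ⟨f, fun u v => ?_⟩
  have hu := hf u
  have hv := hf v
  generalize f u = x at hu ⊢
  generalize f v = y at hv ⊢
  rcases x with _ | i <;> rcases y with _ | j <;>
    simp only [Option.elim_none, Option.elim_some] at hu hv
  · simpa using hadj 0 (by simp [hu]) (by simp [hv])
  · simpa using hadj j (by simp [hu]) hv.ge
  · simpa using hadj i hu.ge (by simp [hv])
  · simp only [Option.mem_some_iff, forall_eq']
    rcases eq_or_ne i j with rfl | hij
    · simpa [mem_arc] using hadj i hu.ge hv.ge
    · rw [hc.adj_iff_of_closedTrace_eq_arc ha hind hfree hij hu hv, iff_and_self]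
      rintro - rfl
      exact hij (arc_injective hn (hu.symm.trans hv))

theorem exists_isHole (ha : 2 ≤ a) (hind : G.IndepSetFree (a + 1))
    (hfree : HoleFreeUpTo G (2 * a)) (hG : ¬ IsChordal G) :
    ∃ c : ZMod (2 * a + 1) → V, IsHole G c := by
  simp only [IsChordal, not_forall, not_not] at hG
  obtain ⟨k, hk, ⟨φ⟩⟩ := hG
  have hak : 2 * a < k := by
    by_contra! hka
    exact hfree k hk hka ⟨φ⟩
  obtain rfl : k = 2 * a + 1 := by
    by_contra hne
    let g : Fin (a + 1) → Fin k := fun m => ⟨2 * m.val, by omega⟩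
    have hg : Function.Injective g := fun x y h => by
      have := congrArg Fin.val h
      grind
    obtain ⟨x, y, hxy⟩ := exists_adj_of_indepSetFree hind (φ.injective.comp hg)
    rw [Function.comp_apply, Function.comp_apply, φ.map_adj_iff,
      cycleGraph_adj_iff_val (by omega)] at hxy
    simp only [g] at hxy
    omega
  refine ⟨fun i => φ ⟨i.val, ZMod.val_lt i⟩, fun i j hij => ?_, fun i j => ?_⟩
  · exact ZMod.val_injective _ (Fin.ext_iff.1 (φ.injective hij))
  · rw [φ.map_adj_iff, cycleGraph_adj_iff_val (by omega), eq_add_one_iff_val (by omega),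
      eq_add_one_iff_val (by omega)]
    dsimp only
    omega

end Classification

/-! ### Wheel inflations -/

/-- `p` exhibits `G` as a clique inflation of the wheel with hub `0` and rim `1, …, n`: two vertices
are adjacent if and only if their labels are equal or adjacent in the wheel. Classes may be
empty. -/
structure IsWheelInflation (G : SimpleGraph V) (n : ℕ) (p : V → ℕ) : Prop where
  le : ∀ v, p v ≤ n
  adj_iff : ∀ u v, G.Adj u v ↔ u ≠ v ∧ (p u = 0 ∨ p v = 0 ∨ p u = p v ∨ p v = p u + 1 ∨
    p u = p v + 1 ∨ (p u = 1 ∧ p v = n) ∨ (p v = 1 ∧ p u = n))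

theorem isWheelInflation_of_label {n : ℕ} [NeZero n] (hn : 2 ≤ n) {f : V → Option (ZMod n)}
    (hf : ∀ u v, G.Adj u v ↔ u ≠ v ∧ ∀ i ∈ f u, ∀ j ∈ f v, j ∈ arc i) (i₀ : ZMod n) :
    IsWheelInflation G n fun v => (f v).elim 0 fun i => (i - i₀).val + 1 := by
  refine ⟨fun v => ?_, fun u v => ?_⟩
  · cases f v with
    | none => exact n.zero_le
    | some i => exact ZMod.val_lt (i - i₀)
  · rw [hf]
    generalize f u = x
    generalize f v = y
    rcases x with _ | i <;> rcases y with _ | j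
    iterate 3 simp
    simp only [Option.mem_some_iff, forall_eq', Option.elim_some, and_congr_right_iff]
    rintro -
    have hij := eq_add_one_iff_val hn (i - i₀) (j - i₀)
    have hji := eq_add_one_iff_val hn (j - i₀) (i - i₀)
    have heq : j = i ↔ (j - i₀).val = (i - i₀).val := by
      rw [(ZMod.val_injective n).eq_iff, sub_left_inj]
    rw [sub_add_eq_add_sub, sub_left_inj] at hij hji
    rw [mem_arc, eq_sub_iff_add_eq, eq_comm (a := j + 1), hij, hji, heq]
    omega

theorem IsHole.exists_isWheelInflation [Fintype V] {a : ℕ} {c : ZMod (2 * a + 1) → V}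
    (ha : 2 ≤ a) (hind : G.IndepSetFree (a + 1)) (hfree : HoleFreeUpTo G (2 * a))
    (hc : IsHole G c) : ∃ p, IsWheelInflation G (2 * a + 1) p ∧
      ∀ j, 1 ≤ j → j ≤ 2 * a + 1 → #{v | p v = 2 * a + 1} ≤ #{v | p v = j} := by
  obtain ⟨f, hf⟩ := hc.exists_label ha hind hfree
  obtain ⟨k, hk⟩ := Finite.exists_min fun i => #{v | f v = some i}
  have hp := isWheelInflation_of_label (by omega) hf (k + 1)
  have hclass {j : ℕ} (hj : 1 ≤ j) (hj' : j ≤ 2 * a + 1) (v : V) :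
      (f v).elim 0 (fun i => (i - (k + 1)).val + 1) = j ↔ f v = some (k + j) := by
    obtain ⟨m, rfl⟩ := Nat.exists_eq_add_of_le' hj
    cases f v with
    | none => simp
    | some i =>
      have hm : ((m : ZMod (2 * a + 1))).val = m := ZMod.val_natCast_of_lt hj'
      rw [Option.elim_some, add_left_inj, Option.some_inj]
      nth_rw 1 [← hm]
      rw [(ZMod.val_injective _).eq_iff, sub_eq_iff_eq_add, Nat.cast_succ]
      ring_nf
  refine ⟨_, hp, fun j hj hj' => ?_⟩
  simp only [hclass le_add_self le_rfl, hclass hj hj', ZMod.natCast_self, add_zero]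
  exact hk _

/-- `r` numbers the vertices of each fibre of `p` by consecutive naturals starting with `0`. -/
def IsFiberRank [Fintype V] (p r : V → ℕ) : Prop :=
  ∀ j, Set.BijOn r {v | p v = j} (Set.Iio #{v | p v = j})

theorem exists_isFiberRank [Fintype V] (p : V → ℕ) : ∃ r, IsFiberRank p r := by
  have hnum (j : ℕ) : ∃ r : V → ℕ, Set.BijOn r {v | p v = j} (Set.Iio #{v | p v = j}) := by
    have h : (({v | p v = j} : Finset V) : Set V).encard =
        (Set.Iio #{v | p v = j} : Set ℕ).encard := by
      rw [← coe_range, Set.encard_coe_eq_coe_finsetCard, Set.encard_coe_eq_coe_finsetCard,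
        card_range]
    simpa using (finite_toSet _).exists_bijOn_of_encard_eq h
  choose r hr using hnum
  exact ⟨fun v => r (p v) v, fun j => (hr j).congr fun v (hv : p v = j) => by rw [hv]⟩

theorem IsFiberRank.lt [Fintype V] {p r : V → ℕ} (hr : IsFiberRank p r) (v : V) :
    r v < #{u | p u = p v} :=
  (hr (p v)).mapsTo rfl

theorem IsFiberRank.ext [Fintype V] {p r : V → ℕ} (hr : IsFiberRank p r) {u v : V}
    (h : p u = p v) (h' : r u = r v) : u = v :=
  (hr (p v)).injOn h rfl h'

theorem IsFiberRank.exists_eq [Fintype V] {p r : V → ℕ} (hr : IsFiberRank p r) {j k : ℕ}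
    (hk : k < #{v | p v = j}) : ∃ v, p v = j ∧ r v = k :=
  (hr j).surjOn hk

theorem IsFiberRank.card_filter_lt [Fintype V] {p r : V → ℕ} (hr : IsFiberRank p r) {j k : ℕ}
    (hk : k ≤ #{v | p v = j}) : #{v | p v = j ∧ r v < k} = k := by
  rw [← card_range k]
  refine card_nbij r (fun v hv => by simp_all) (fun u hu v hv h => ?_) fun m hm => ?_
  · simp only [coe_filter, mem_univ, true_and, Set.mem_ofPred_eq] at hu hv
    exact hr.ext (hu.1.trans hv.1.symm) h
  · rw [coe_range, Set.mem_Iio] at hm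
    obtain ⟨v, hv, rfl⟩ := hr.exists_eq (hm.trans_le hk)
    exact ⟨v, by simp_all, rfl⟩

/-! ### Colouring a wheel inflation -/

section Color

variable {c i x y j r s k l : ℕ}

/-- The colour of vertex number `r` of the rim class `j` when colours `0, …, c - 1` are available:
the odd classes use them from the bottom, the even classes from the top. -/
def zigzagColor (c j r : ℕ) : ℕ :=
  if Odd j then r else c - 1 - r

theorem zigzagColor_lt (hr : r < c) : zigzagColor c j r < c := by
  unfold zigzagColor
  split_ifs <;> omega

theorem zigzagColor_inj (hr : r < c) (hs : s < c) :
    zigzagColor c j r = zigzagColor c j s ↔ r = s := by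
  unfold zigzagColor
  split_ifs <;> omega

theorem zigzagColor_ne_zigzagColor_succ (hr : r < k) (hs : s < l) (h : k + l ≤ c) :
    zigzagColor c j r ≠ zigzagColor c (j + 1) s := by
  simp only [zigzagColor, Nat.odd_add_one]
  split_ifs <;> omega

/-- The permutation of `ℕ` exchanging the blocks `[0, y)` and `[y, y + x)`. -/
def blockSwap (x y b : ℕ) : ℕ :=
  if b < y then b + x else if b < y + x then b - y else b

theorem blockSwap_injective (x y : ℕ) : Function.Injective (blockSwap x y) := by
  intro b b' h
  unfold blockSwap at h
  split_ifs at h <;> omega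

theorem blockSwap_lt {b : ℕ} (hxy : x + y ≤ c) (hb : b < c) : blockSwap x y b < c := by
  unfold blockSwap
  split_ifs <;> omega

theorem blockSwap_zigzagColor (hj : Even j) (hr : r < k) (h : x + y + k ≤ c) :
    blockSwap x y (zigzagColor c j r) = zigzagColor c j r := by
  rw [zigzagColor, if_neg (Nat.not_odd_iff_even.2 hj), blockSwap, if_neg (by omega),
    if_neg (by omega)]

/-- The zigzag colouring, with the lowest colours exchanged in the classes after `i`. The first
class has colours in `[0, x)`; an odd last class with at most `y` vertices now has its colours in
`[x, x + y)`. -/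
def rimColor (c i x y j r : ℕ) : ℕ :=
  if j ≤ i then zigzagColor c j r else blockSwap x y (zigzagColor c j r)

theorem rimColor_lt (hxy : x + y ≤ c) (hr : r < c) : rimColor c i x y j r < c := by
  unfold rimColor
  split_ifs
  exacts [zigzagColor_lt hr, blockSwap_lt hxy (zigzagColor_lt hr)]

theorem rimColor_inj (hr : r < c) (hs : s < c) :
    rimColor c i x y j r = rimColor c i x y j s ↔ r = s := by
  rw [← zigzagColor_inj (j := j) hr hs]
  unfold rimColor
  split_ifs
  exacts [Iff.rfl, (blockSwap_injective x y).eq_iff]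

-- The exchange does not affect the colours of class `i`.
theorem rimColor_ne_rimColor_succ (hi : Even i) (hr : r < k) (hs : s < l) (h : k + l ≤ c)
    (hxy : j = i → x + y + k ≤ c) : rimColor c i x y j r ≠ rimColor c i x y (j + 1) s := by
  have hne := zigzagColor_ne_zigzagColor_succ (j := j) hr hs h
  rcases lt_or_ge j i with hji | hij
  · rwa [rimColor, rimColor, if_pos hji.le, if_pos (Nat.succ_le_of_lt hji)]
  have hj : rimColor c i x y j r = blockSwap x y (zigzagColor c j r) := by
    rcases hij.eq_or_lt with rfl | hij
    · rw [rimColor, if_pos le_rfl, blockSwap_zigzagColor hi hr (hxy rfl)]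
    · rw [rimColor, if_neg hij.not_ge]
  rw [hj, rimColor, if_neg (by omega)]
  exact (blockSwap_injective x y).ne hne

theorem rimColor_one_ne_rimColor (hi : 1 ≤ i) (hij : i < j) (hj : Odd j) (hr : r < x)
    (hs : s < y) : rimColor c i x y 1 r ≠ rimColor c i x y j s := by
  rw [rimColor, if_pos hi, rimColor, if_neg (by omega), zigzagColor, if_pos odd_one, zigzagColor,
    if_pos hj, blockSwap, if_pos hs]
  omega

end Color

theorem colorable_card_add_of_induce_compl {S : Finset V} {c : ℕ}
    (h : (G.induce (S : Set V)ᶜ).Colorable c) : G.Colorable (#S + c) := by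
  classical
  obtain ⟨f⟩ := h
  let col (v : V) : S ⊕ Fin c := if hv : v ∈ S then .inl ⟨v, hv⟩ else .inr (f ⟨v, hv⟩)
  have hcol {u v : V} (huv : G.Adj u v) : col u ≠ col v := by
    by_cases hu : u ∈ S <;> by_cases hv : v ∈ S <;> simp only [col, hu, hv, ↓reduceDIte]
    · simpa using huv.ne
    · simp
    · simp
    · simpa using f.valid (induce_adj.2 huv)
  simpa using (Coloring.mk col hcol).colorable

section Colorable

variable [Fintype V] {a c i : ℕ} {p r : V → ℕ}

theorem IsWheelInflation.rank_lt (ha : 1 ≤ a) (hp : IsWheelInflation G (2 * a + 1) p)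
    (hr : IsFiberRank p r)
    (hsum : ∀ j, 1 ≤ j → j ≤ 2 * a → #{v | p v = j} + #{v | p v = j + 1} ≤ c) {v : V}
    (hv : p v ≠ 0) : r v < c := by
  have hrv := hr.lt v
  rcases (hp.le v).eq_or_lt with h | h
  · have := hsum (2 * a) (by omega) le_rfl
    rw [h] at hrv
    omega
  · have := hsum (p v) (by omega) (by omega)
    omega

theorem IsWheelInflation.rimColor_ne_of_adj (hp : IsWheelInflation G (2 * a + 1) p)
    (hr : IsFiberRank p r) (hi : Even i) (hi1 : 1 ≤ i) (hia : i ≤ 2 * a)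
    (hsum : ∀ j, 1 ≤ j → j ≤ 2 * a → #{v | p v = j} + #{v | p v = j + 1} ≤ c)
    (hmid : #{v | p v = 1} + #{v | p v = 2 * a + 1} + #{v | p v = i} ≤ c) {u v : V}
    (hu : p u ≠ 0) (huv : p u ≤ p v) (hadj : G.Adj u v) :
    rimColor c i #{v | p v = 1} #{v | p v = 2 * a + 1} (p u) (r u) ≠
      rimColor c i #{v | p v = 1} #{v | p v = 2 * a + 1} (p v) (r v) := by
  obtain ⟨hne, h⟩ := (hp.adj_iff u v).1 hadj
  have hcases : p v = p u ∨ p v = p u + 1 ∨ (p u = 1 ∧ p v = 2 * a + 1) := by omega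
  have hru := hr.lt u
  have hrv := hr.lt v
  have hlt {w : V} (hw : p w ≠ 0) : r w < c := hp.rank_lt (by omega) hr hsum hw
  rcases hcases with h | h | ⟨h, h'⟩
  · rw [h, Ne, rimColor_inj (hlt hu) (hlt (by omega))]
    exact fun h' => hne (hr.ext h.symm h')
  · have := hp.le v
    rw [h] at hrv ⊢
    exact rimColor_ne_rimColor_succ hi hru hrv (hsum _ (by omega) (by omega))
      fun hui => hui ▸ hmid
  · rw [h] at hru
    rw [h'] at hrv
    rw [h, h']
    exact rimColor_one_ne_rimColor hi1 (by omega) ⟨a, rfl⟩ hru hrv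

theorem IsWheelInflation.colorable (hp : IsWheelInflation G (2 * a + 1) p) (hi : Even i)
    (hi1 : 1 ≤ i) (hia : i ≤ 2 * a)
    (hsum : ∀ j, 1 ≤ j → j ≤ 2 * a → #{v | p v = j} + #{v | p v = j + 1} ≤ c)
    (hmid : #{v | p v = 1} + #{v | p v = 2 * a + 1} + #{v | p v = i} ≤ c) :
    G.Colorable (#{v | p v = 0} + c) := by
  obtain ⟨r, hr⟩ := exists_isFiberRank p
  let col (v : V) : ℕ := rimColor c i #{v | p v = 1} #{v | p v = 2 * a + 1} (p v) (r v)
  have hpos (v : ↥(({v | p v = 0} : Finset V) : Set V)ᶜ) : p v ≠ 0 := by simpa using v.2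
  have hcol (v : ↥(({v | p v = 0} : Finset V) : Set V)ᶜ) : col v < c :=
    rimColor_lt (by omega) (hp.rank_lt (by omega) hr hsum (hpos v))
  refine colorable_card_add_of_induce_compl ⟨Coloring.mk (fun v => ⟨col v, hcol v⟩) ?_⟩
  intro u v huv h
  rw [Fin.mk.injEq] at h
  rw [induce_adj] at huv
  rcases le_total (p u) (p v) with hle | hle
  · exact hp.rimColor_ne_of_adj hr hi hi1 hia hsum hmid (hpos u) hle huv h
  · exact hp.rimColor_ne_of_adj hr hi hi1 hia hsum hmid (hpos v) hle huv.symm h.symm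

end Colorable

/-! ### Immersions in a wheel inflation -/

section Immersion

variable [Fintype V] {a n k : ℕ} {p r : V → ℕ}

theorem card_filter_eq_or_or (p : V → ℕ) {i j k : ℕ} (hij : i ≠ j) (hik : i ≠ k) (hjk : j ≠ k) :
    #{v | p v = i ∨ p v = j ∨ p v = k} =
      #{v | p v = i} + #{v | p v = j} + #{v | p v = k} := by
  classical
  rw [filter_or, filter_or, card_union_of_disjoint, card_union_of_disjoint, add_assoc]
  · exact disjoint_filter.2 fun v _ hj hk => hjk (hj.symm.trans hk)
  · rw [← filter_or]
    exact disjoint_filter.2 fun v _ hi h => by omega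

theorem IsWheelInflation.containsImmersion_of_le (hp : IsWheelInflation G n p) {i j t : ℕ}
    (hi : 1 ≤ i) (hij : j = i + 1 ∨ (i = 1 ∧ j = n ∧ 1 < n))
    (ht : t ≤ #{v | p v = 0} + #{v | p v = i} + #{v | p v = j}) :
    G.ContainsImmersion (completeGraph (Fin t)) := by
  have hi' : 0 ≠ i := by omega
  have hj : 0 ≠ j := by omega
  have hij' : i ≠ j := by omega
  rw [← card_filter_eq_or_or p hi' hj hij'] at ht
  refine containsImmersion_of_isClique (fun u hu v hv huv => ?_) ht
  simp only [coe_filter, mem_univ, true_and, Set.mem_ofPred_eq] at hu hv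
  exact (hp.adj_iff u v).2 ⟨huv, by omega⟩

theorem IsWheelInflation.exists_walk (hp : IsWheelInflation G n p) (hr : IsFiberRank p r)
    {ρ : ℕ → ℕ} {y : V} (hy : r y = ρ (p y)) {m : ℕ} (hm : p y ≤ m)
    (hρ : ∀ j, p y < j → j ≤ m → ρ j < #{v | p v = j}) :
    ∃ (x : V) (w : G.Walk y x), p x = m ∧ r x = ρ m ∧
      ∀ z ∈ w.support, p y ≤ p z ∧ r z = ρ (p z) := by
  induction m, hm using Nat.le_induction with
  | base => exact ⟨y, .nil, rfl, hy, by simp [hy]⟩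
  | succ m hm ih =>
    obtain ⟨x, w, hx, -, hw⟩ := ih fun j hj hjm => hρ j hj (by omega)
    obtain ⟨x', hx', hrx'⟩ := hr.exists_eq (hρ (m + 1) (by omega) le_rfl)
    have hadj : G.Adj x x' :=
      (hp.adj_iff x x').2 ⟨fun h => by rw [h, hx'] at hx; omega, by omega⟩
    refine ⟨x', w.concat hadj, hx', hrx', fun z hz => ?_⟩
    rw [Walk.support_concat, List.mem_append, List.mem_singleton] at hz
    rcases hz with hz | rfl
    · exact hw z hz
    · exact ⟨by omega, by rw [hx', hrx']⟩

/-- The rim of an odd wheel folded onto its first three classes: every class from `4` on goes to the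
class of its parity among `2` and `3`. Together with the ranks, it tells the paths of the immersion
apart. -/
def foldLabel (j : ℕ) : ℕ :=
  if j ≤ 1 then j else if Even j then 2 else 3

theorem IsWheelInflation.exists_walk_fold (hp : IsWheelInflation G (2 * a + 1) p)
    (hr : IsFiberRank p r) {x y : V} (hx : p x = 2 * a + 1) (hy : p y = 2)
    (heven : ∀ j, Even j → 2 ≤ j → j ≤ 2 * a → r y < #{v | p v = j})
    (hodd : ∀ j, Odd j → 3 ≤ j → j ≤ 2 * a + 1 → r x < #{v | p v = j}) :
    ∃ w : G.Walk y x,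
      (∀ e ∈ w.edges, e.map (fun v => (foldLabel (p v), r v)) = s((2, r y), (3, r x))) ∧
      ∀ z ∈ w.support, 2 ≤ p z ∧ r z = if Even (p z) then r y else r x := by
  let ρ (j : ℕ) : ℕ := if Even j then r y else r x
  obtain ⟨x', w, hx', hrx', hw⟩ := hp.exists_walk hr (ρ := ρ) (y := y) (m := 2 * a + 1)
    (by simp [ρ, hy]) (by have := hp.le y; omega) fun j hj hjm => by
      dsimp only [ρ]
      split_ifs with hpar
      · exact heven j hpar (by omega) (by grind)
      · exact hodd j (Nat.not_even_iff_odd.1 hpar) (by omega) hjm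
  obtain rfl : x' = x := hr.ext (hx'.trans hx.symm) (by simpa [ρ] using hrx')
  rw [hy] at hw
  refine ⟨w, fun e he => ?_, hw⟩
  induction e with | _ u v
  obtain ⟨hu, hru⟩ := hw u (w.fst_mem_support_of_mem_edges he)
  obtain ⟨hv, hrv⟩ := hw v (w.snd_mem_support_of_mem_edges he)
  obtain ⟨hne, hadj⟩ := (hp.adj_iff u v).1 (w.adj_of_mem_edges he)
  have hlabel : p u ≠ p v := fun h => hne (hr.ext h (by rw [hru, hrv, h]))
  have hpar : Even (p u) ↔ ¬ Even (p v) := by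
    rcases (by omega : p v = p u + 1 ∨ p u = p v + 1) with h | h <;> simp [h, Nat.even_add_one]
  have hfold {z : V} (hz : 2 ≤ p z) : foldLabel (p z) = if Even (p z) then 2 else 3 :=
    if_neg (by omega)
  rw [Sym2.map_mk, hfold hu, hfold hv, hru, hrv]
  by_cases h : Even (p v)
  · simp [ρ, hpar, h, Sym2.eq_swap]
  · simp [ρ, hpar, h]

theorem foldLabel_of_odd {j : ℕ} (hj : Odd j) (hj1 : 1 < j) : foldLabel j = 3 := by
  rw [foldLabel, if_neg (by omega), if_neg (Nat.not_even_iff_odd.2 hj)]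

/-- The branch vertices of the immersion: the hub, the first and the last rim class, and the first
`k` vertices of the second class. -/
def branchSet (a k : ℕ) (p r : V → ℕ) : Finset V :=
  {v | (p v = 0 ∨ p v = 1 ∨ p v = 2 * a + 1) ∨ (p v = 2 ∧ r v < k)}

theorem mem_branchSet {v : V} : v ∈ branchSet a k p r ↔
    (p v = 0 ∨ p v = 1 ∨ p v = 2 * a + 1) ∨ (p v = 2 ∧ r v < k) := by
  simp [branchSet]

theorem card_branchSet (ha : 1 ≤ a) (hr : IsFiberRank p r) (hk : k ≤ #{v | p v = 2}) :
    #(branchSet a k p r) =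
      #{v | p v = 0} + #{v | p v = 1} + #{v | p v = 2 * a + 1} + k := by
  classical
  rw [branchSet, filter_or, card_union_of_disjoint, hr.card_filter_lt hk,
    card_filter_eq_or_or p (by omega) (by omega) (by omega)]
  exact disjoint_filter.2 fun v _ h h' => by omega

theorem injOn_fold_branchSet (ha : 1 ≤ a) (hr : IsFiberRank p r) :
    Set.InjOn (fun v => (foldLabel (p v), r v)) (branchSet a k p r) := by
  intro u hu v hv h
  obtain ⟨hlabel, hrank⟩ := Prod.mk.inj h
  refine hr.ext ?_ hrank
  have hlast := foldLabel_of_odd (odd_two_mul_add_one a) (by omega)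
  have h0 : foldLabel 0 = 0 := rfl
  have h1 : foldLabel 1 = 1 := rfl
  have h2 : foldLabel 2 = 2 := rfl
  rw [mem_coe, mem_branchSet] at hu hv
  grind

theorem IsWheelInflation.exists_walk_branchSet (ha : 2 ≤ a)
    (hp : IsWheelInflation G (2 * a + 1) p) (hr : IsFiberRank p r)
    (heven : ∀ j, Even j → 2 ≤ j → j ≤ 2 * a → k ≤ #{v | p v = j})
    (hodd : ∀ j, 1 ≤ j → j ≤ 2 * a + 1 → #{v | p v = 2 * a + 1} ≤ #{v | p v = j}) {x y : V}
    (hx : p x = 2 * a + 1) (hy : p y = 2) (hyk : r y < k) :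
    ∃ w : G.Walk y x,
      (∀ e ∈ w.edges, e.map (fun v => (foldLabel (p v), r v)) =
        s((foldLabel (p y), r y), (foldLabel (p x), r x))) ∧
      ∀ z ∈ w.support, z ∈ branchSet a k p r → z = y ∨ z = x := by
  have hrx : r x < #{v | p v = 2 * a + 1} := hx ▸ hr.lt x
  obtain ⟨w, hw, hw'⟩ := hp.exists_walk_fold hr hx hy
    (fun j hj hj2 hja => hyk.trans_le (heven j hj hj2 hja))
    (fun j _ hj3 hja => hrx.trans_le (hodd j (by omega) hja))
  refine ⟨w, fun e he => ?_, fun z hz hzS => ?_⟩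
  · rw [hw e he, hx, hy, foldLabel_of_odd (odd_two_mul_add_one a) (by omega)]
    rfl
  · obtain ⟨hz2, hrz⟩ := hw' z hz
    rcases mem_branchSet.1 hzS with (h | h | h) | ⟨h, -⟩
    · omega
    · omega
    · exact .inr (hr.ext (h.trans hx.symm) (by simpa [h] using hrz))
    · exact .inl (hr.ext (h.trans hy.symm) (by simpa [h] using hrz))

theorem IsWheelInflation.containsImmersion_branchSet (ha : 2 ≤ a)
    (hp : IsWheelInflation G (2 * a + 1) p) (hr : IsFiberRank p r)
    (heven : ∀ j, Even j → 2 ≤ j → j ≤ 2 * a → k ≤ #{v | p v = j})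
    (hodd : ∀ j, 1 ≤ j → j ≤ 2 * a + 1 → #{v | p v = 2 * a + 1} ≤ #{v | p v = j}) :
    G.ContainsImmersion (completeGraph (Fin #(branchSet a k p r))) := by
  refine containsImmersion_completeGraph_of_walks _ (injOn_fold_branchSet (by omega) hr)
    fun x hx y hy hxy => ?_
  by_cases hadj : G.Adj x y
  · exact ⟨hadj.toWalk, by simp, by simp⟩
  have hlabels : (p x = 2 * a + 1 ∧ p y = 2 ∧ r y < k) ∨
      (p y = 2 * a + 1 ∧ p x = 2 ∧ r x < k) := by
    rw [hp.adj_iff, not_and] at hadj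
    have := hadj hxy
    rw [mem_branchSet] at hx hy
    omega
  rcases hlabels with ⟨hpx, hpy, hry⟩ | ⟨hpy, hpx, hrx⟩
  · obtain ⟨w, hw, hw'⟩ := hp.exists_walk_branchSet ha hr heven hodd hpx hpy hry
    refine ⟨w.reverse, fun e he => ?_, fun z hz hzS => ?_⟩
    · rw [hw e (by simpa using he), Sym2.eq_swap]
    · exact (hw' z (by simpa using hz) hzS).symm
  · exact hp.exists_walk_branchSet ha hr heven hodd hpy hpx hrx

theorem IsWheelInflation.containsImmersion_of_not_colorable (ha : 2 ≤ a)
    (hp : IsWheelInflation G (2 * a + 1) p)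
    (hmin : ∀ j, 1 ≤ j → j ≤ 2 * a + 1 → #{v | p v = 2 * a + 1} ≤ #{v | p v = j}) {s : ℕ}
    (hs : ¬ G.Colorable s) : G.ContainsImmersion (completeGraph (Fin (s + 1))) := by
  by_contra hK
  obtain ⟨r, hr⟩ := exists_isFiberRank p
  have hclique {i j : ℕ} (hi : 1 ≤ i) (hij : j = i + 1 ∨ (i = 1 ∧ j = 2 * a + 1 ∧ 1 < 2 * a + 1)) :
      #{v | p v = 0} + #{v | p v = i} + #{v | p v = j} ≤ s := by
    by_contra! hlt
    exact hK (hp.containsImmersion_of_le hi hij hlt)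
  have hwrap := hclique le_rfl (.inr ⟨rfl, rfl, by omega⟩)
  obtain ⟨k, hk⟩ : ∃ k, #{v | p v = 0} + #{v | p v = 1} + #{v | p v = 2 * a + 1} + k = s + 1 :=
    ⟨_, Nat.add_sub_of_le (by omega)⟩
  have heven (i : ℕ) (hi : Even i) (hi2 : 2 ≤ i) (hia : i ≤ 2 * a) : k ≤ #{v | p v = i} := by
    by_contra! hlt
    have hcol := hp.colorable (c := s - #{v | p v = 0}) hi (by omega) hia (fun j hj _ => by
      have := hclique hj (.inl rfl)
      omega) (by omega)
    rw [Nat.add_sub_of_le (by omega)] at hcol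
    exact hs hcol
  have himm := hp.containsImmersion_branchSet ha hr heven hmin
  rw [card_branchSet (by omega) hr (heven 2 even_two le_rfl (by omega)), hk] at himm
  exact hK himm

end Immersion

theorem containsImmersion_of_not_colorable [Finite V] {a s : ℕ} (ha : 2 ≤ a)
    (hind : G.IndepSetFree (a + 1)) (hfree : HoleFreeUpTo G (2 * a)) (hs : ¬ G.Colorable s) :
    G.ContainsImmersion (completeGraph (Fin (s + 1))) := by
  have := Fintype.ofFinite V
  by_cases hG : IsChordal G
  · have hclique : ¬ G.CliqueFree (s + 1) := fun h => hs (hG.colorable h)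
    obtain ⟨S, hS⟩ := not_forall_not.1 hclique
    exact containsImmersion_of_isClique hS.isClique hS.card_eq.ge
  · obtain ⟨c, hc⟩ := exists_isHole ha hind hfree hG
    obtain ⟨p, hp, hmin⟩ := hc.exists_isWheelInflation ha hind hfree
    exact hp.containsImmersion_of_not_colorable ha hmin hs

end LescureMeyniel

theorem theorem3 {V : Type*} [Finite V] (G : SimpleGraph V)
    (hα : 2 ≤ G.indepNum)
    (hfree : ∀ k : ℕ, 4 ≤ k → k ≤ 2 * G.indepNum →
      ¬ (SimpleGraph.cycleGraph k).IsIndContained G) :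
    G.SatisfiesLescureMeyniel := by
  have := Fintype.ofFinite V
  have hind : G.IndepSetFree (G.indepNum + 1) := fun S hS => by
    have := hS.isIndepSet.card_le_indepNum
    rw [hS.card_eq] at this
    omega
  obtain ⟨t, ht⟩ := ENat.ne_top_iff_exists.1
    (SimpleGraph.chromaticNumber_ne_top_iff_exists.2 ⟨_, G.colorable_of_fintype⟩)
  refine ⟨t, ht.symm, ?_⟩
  cases t with
  | zero => exact LescureMeyniel.containsImmersion_of_isClique (S := ∅) (by simp) le_rfl
  | succ s =>
    refine LescureMeyniel.containsImmersion_of_not_colorable hα hind hfree fun hs => ?_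
    have := hs.chromaticNumber_le
    rw [← ht, Nat.cast_le] at this
    omega
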